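/- **Zariski's Main Theorem for complex algebraic varieties.** Let $X$ and $Y$ be irreducible complex algebraic varieties, i.e. reduced, irreducible, separated schemes of finite type over $\operatorname{Spec}\mathbb{C}$, and assume that $Y$ is normal (all its local rings are integrally closed domains). Let $f : X \to Y$ be a morphism over $\mathbb{C}$. Then $f$ is an open immersion if and only if $f$ is birational and has finite fibres. Here $f$ is called birational if it restricts to an isomorphism from some dense open subscheme of $X$ onto a dense open subscheme of $Y$, and $f$ has finite fibres if, for every closed point $y$ of $Y$, there are only finitely many closed points $x$ of $X$ with $f(x) = y$. -/

import Mathlib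

open CategoryTheory AlgebraicGeometry

/-- `p : X ⟶ Spec ℂ` makes `X` an irreducible complex algebraic variety: a separated scheme of
finite type over `ℂ` which is reduced and irreducible (so, in particular, non-empty). -/
structure IsIrreducibleComplexVariety {X : Scheme.{0}} (p : X ⟶ Spec (CommRingCat.of ℂ)) :
    Prop where
  isSeparated : IsSeparated p
  locallyOfFiniteType : LocallyOfFiniteType p
  quasiCompact : QuasiCompact p
  isReduced : IsReduced X
  irreducibleSpace : IrreducibleSpace X

/-- A scheme is normal if all its local rings are integrally closed domains. -/
def IsNormalScheme (X : Scheme.{0}) : Prop :=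
  ∀ x : X, IsDomain (X.presheaf.stalk x) ∧ IsIntegrallyClosed (X.presheaf.stalk x)

/-- A morphism is birational if it restricts to an isomorphism from some dense open subscheme of
its source onto a dense open subscheme of its target. -/
def IsBirationalMorphism {X Y : Scheme.{0}} (f : X ⟶ Y) : Prop :=
  ∃ e : X.PartialIso Y, e.iso.hom ≫ e.target.ι = e.source.ι ≫ f

/-- For a morphism of complex varieties: every fibre of the induced map between the sets of closed
points (the points in the sense of classical varieties) is finite. -/
def HasFiniteFibres {X Y : Scheme.{0}} (f : X ⟶ Y) : Prop :=
  ∀ y ∈ closedPoints Y, {x ∈ closedPoints X | f x = y}.Finite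

/-!
Suppose `f` is birational with finite fibres. The closed points of a variety are dense in each of
its closed subsets, so a set-theoretic fibre of `f` over a closed point has only finitely many
points, all of them closed, and is therefore discrete. Hence `f` is quasi-finite at every closed
point of `X`. Since the quasi-finite locus is open and every non-empty closed subset of `X` contains
a closed point, `f` is quasi-finite
(`AlgebraicGeometry.LocallyQuasiFinite.of_finite_inter_closedPoints`).

Grothendieck's form of Zariski's Main Theorem, which is in Mathlib, now factors `f` as an open
immersion of `X` into the relative normalization of `Y` in `X`, followed by the structure morphism
of the latter. Over an affine open `U ⊆ Y` that morphism is given by the inclusion of `Γ(Y, U)` into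
its integral closure in `Γ(X, f ⁻¹ᵁ U)`. By birationality `Γ(X, f ⁻¹ᵁ U)` lies in the function field
of `Y`, where `Γ(Y, U)` is integrally closed because `Y` is normal; so the morphism is an
isomorphism (`AlgebraicGeometry.Scheme.Hom.isIso_fromNormalization`) and `f` is an open immersion.

Conversely, an open immersion is injective, and an isomorphism onto its image, which is dense
because `Y` is irreducible.
-/

namespace AlgebraicGeometry

universe u

/-! ### Quasi-finiteness from finite fibres over closed points -/

lemma LocallyQuasiFinite.of_finite_inter_closedPoints {X Y : Scheme.{u}} (f : X ⟶ Y)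
    [LocallyOfFiniteType f] [JacobsonSpace Y]
    (hf : ∀ y ∈ closedPoints Y, {x ∈ closedPoints X | f x = y}.Finite) :
    LocallyQuasiFinite f := by
  have : JacobsonSpace X := LocallyOfFiniteType.jacobsonSpace f
  rw [← Scheme.Hom.quasiFiniteLocus_eq_top_iff]
  by_contra hne
  -- A closed point outside the quasi-finite locus exists because `X` is a Jacobson space.
  obtain ⟨x, hxf, hx⟩ := nonempty_inter_closedPoints
    (Z := (f.quasiFiniteLocus : Set X)ᶜ)
    (Set.nonempty_compl.mpr fun h ↦ hne (TopologicalSpace.Opens.ext h))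
    f.quasiFiniteLocus.isOpen.isClosed_compl.isLocallyClosed
  have hy : f x ∈ closedPoints Y := f.closePoints_subset_preimage_closedPoints hx
  have hemb : Topology.IsClosedEmbedding (Subtype.val : f ⁻¹' {f x} → X) :=
    (IsClosed.preimage f.continuous hy).isClosedEmbedding_subtypeVal
  have : JacobsonSpace (f ⁻¹' {f x}) := .of_isClosedEmbedding hemb
  -- The closed points of the closed set `f ⁻¹' {f x}` are those of `X` lying in it. There are
  -- finitely many, and a Jacobson space with finitely many closed points is discrete.
  have : DiscreteTopology (f ⁻¹' {f x}) := by
    refine JacobsonSpace.discreteTopology ?_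
    rw [← hemb.preimage_closedPoints]
    refine Set.Finite.of_finite_image ((hf _ hy).subset ?_) Subtype.val_injective.injOn
    rintro _ ⟨z, hz, rfl⟩
    exact ⟨hz, z.2⟩
  refine hxf (Scheme.Hom.quasiFiniteAt_iff_isOpen_singleton_asFiber.mpr ?_)
  rw [← (f.fiberHomeo (f x)).isOpen_image]
  exact isOpen_discrete _

/-! ### Relative normalization over a normal base -/

lemma IsAffineOpen.isIntegrallyClosed {Y : Scheme.{u}} [IsIntegral Y]
    (hY : ∀ y : Y, IsIntegrallyClosed (Y.presheaf.stalk y))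
    {U : Y.Opens} (hU : IsAffineOpen U) [Nonempty U] : IsIntegrallyClosed Γ(Y, U) := by
  let (x : PrimeSpectrum Γ(Y, U)) : Algebra Γ(Y, U) (Y.presheaf.stalk (hU.fromSpec x)) :=
    TopCat.Presheaf.algebra_section_stalk Y.presheaf _
  have hloc (P : Ideal Γ(Y, U)) [hP : P.IsMaximal] :
      IsLocalization.AtPrime (Y.presheaf.stalk (hU.fromSpec ⟨P, hP.isPrime⟩)) P :=
    hU.isLocalization_stalk' ⟨P, hP.isPrime⟩ (hU.isoSpec.inv _).2
  exact @IsIntegrallyClosed.of_isLocalization_maximal _ _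
    (fun P hP ↦ Y.presheaf.stalk (hU.fromSpec ⟨P, hP.isPrime⟩)) _ _ hloc _ fun _ _ ↦ hY _

/-- On a normal integral scheme, a germ `t` at the generic point that is integral over the
sections on an affine open `U` extends to `U`. The point `y` is only propositionally the generic
point, so that images of generic points can be substituted for it. -/
lemma IsAffineOpen.exists_germ_eq_of_isIntegralElem {Y : Scheme.{u}} [IsIntegral Y]
    (hY : ∀ y : Y, IsIntegrallyClosed (Y.presheaf.stalk y))
    {U : Y.Opens} (hU : IsAffineOpen U) {y : Y} (hy : y = genericPoint Y) (hyU : y ∈ U)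
    {t : Y.presheaf.stalk y} (ht : (Y.presheaf.germ U y hyU).hom.IsIntegralElem t) :
    ∃ r, Y.presheaf.germ U y hyU r = t := by
  subst hy
  have : Nonempty U := ⟨_, hyU⟩
  have := hU.isIntegrallyClosed hY
  have := functionField_isFractionRing_of_isAffineOpen Y U hU
  exact (IsIntegrallyClosed.isIntegral_iff (R := Γ(Y, U)) (K := Y.functionField)).mp ht

namespace Scheme.Hom

lemma isIso_stalkMap_genericPoint_of_isOpenImmersion_ι_comp {X Y : Scheme.{u}}
    [IsIntegral X] (f : X ⟶ Y) (V : X.Opens) [Nonempty V] [IsOpenImmersion (V.ι ≫ f)] :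
    IsIso (f.stalkMap (genericPoint X)) := by
  rw [← genericPoint_eq_of_isOpenImmersion V.ι]
  have : IsIso (f.stalkMap (V.ι (genericPoint V)) ≫ V.ι.stalkMap (genericPoint V)) := by
    rw [← Scheme.Hom.stalkMap_comp]
    exact inferInstanceAs (IsIso ((V.ι ≫ f).stalkMap _))
  exact IsIso.of_isIso_comp_right _ (V.ι.stalkMap (genericPoint V))

variable {X Y : Scheme.{u}} [IsIntegral X] [IsIntegral Y] (f : X ⟶ Y) (V : X.Opens) [Nonempty V]
  [IsOpenImmersion (V.ι ≫ f)]

include V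

lemma apply_genericPoint_of_isOpenImmersion_ι_comp : f (genericPoint X) = genericPoint Y := by
  rw [← genericPoint_eq_of_isOpenImmersion V.ι, ← Scheme.Hom.comp_apply,
    genericPoint_eq_of_isOpenImmersion]

/-- If `Y` is normal and `f` is generically an open immersion, then every section over `f ⁻¹ᵁ U`
that is integral over `Γ(Y, U)` comes from `Γ(Y, U)`. -/
lemma exists_app_eq_of_isIntegralElem (hY : ∀ y : Y, IsIntegrallyClosed (Y.presheaf.stalk y))
    {U : Y.Opens} (hU : IsAffineOpen U) (hξ : f (genericPoint X) ∈ U)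
    {s : Γ(X, f ⁻¹ᵁ U)} (hs : (f.app U).hom.IsIntegralElem s) : ∃ r, f.app U r = s := by
  have := f.isIso_stalkMap_genericPoint_of_isOpenImmersion_ι_comp V
  let ψ := inv (f.stalkMap (genericPoint X))
  let germX := X.presheaf.germ (f ⁻¹ᵁ U) (genericPoint X) hξ
  let germY := Y.presheaf.germ U (f (genericPoint X)) hξ
  have hcomp : germY ≫ f.stalkMap (genericPoint X) = f.app U ≫ germX := f.germ_stalkMap ..
  have hcomp' : f.app U ≫ germX ≫ ψ = germY := by
    rw [← Category.assoc, ← hcomp, Category.assoc, IsIso.hom_inv_id, Category.comp_id]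
  -- Transport `s` to a germ of `Y` at its generic point, and extend that germ to `U`.
  have ht : germY.hom.IsIntegralElem (ψ (germX s)) := by
    obtain ⟨p, hp, hps⟩ := hs
    refine ⟨p, hp, ?_⟩
    have := congr((germX ≫ ψ).hom $hps)
    rw [Polynomial.hom_eval₂, map_zero, ← CommRingCat.hom_comp, hcomp'] at this
    exact this
  obtain ⟨r, hr⟩ := hU.exists_germ_eq_of_isIntegralElem hY
    (f.apply_genericPoint_of_isOpenImmersion_ι_comp V) hξ ht
  refine ⟨r, germ_injective_of_isIntegral X (U := f ⁻¹ᵁ U) _ hξ ?_⟩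
  have h₁ := congr(f.stalkMap (genericPoint X) $hr)
  have h₂ : f.stalkMap (genericPoint X) (ψ (germX s)) = germX s := by
    rw [← CommRingCat.comp_apply, IsIso.inv_hom_id, CommRingCat.id_apply]
  have h₃ : f.stalkMap (genericPoint X) (germY r) = germX (f.app U r) := congr($hcomp r)
  exact h₃.symm.trans (h₁.trans h₂)

lemma app_injective_of_isOpenImmersion_ι_comp {U : Y.Opens} (hξ : f (genericPoint X) ∈ U) :
    Function.Injective (f.app U) := by
  have := f.isIso_stalkMap_genericPoint_of_isOpenImmersion_ι_comp V
  have hinj : Function.Injective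
      (Y.presheaf.germ U (f (genericPoint X)) hξ ≫ f.stalkMap (genericPoint X)) :=
    (ConcreteCategory.bijective_of_isIso (f.stalkMap (genericPoint X))).1.comp
      (germ_injective_of_isIntegral _ _ hξ)
  rw [f.germ_stalkMap] at hinj
  exact Function.Injective.of_comp hinj

lemma isIso_fromNormalization [QuasiCompact f] [QuasiSeparated f]
    (hY : ∀ y : Y, IsIntegrallyClosed (Y.presheaf.stalk y)) : IsIso f.fromNormalization := by
  refine (IsZariskiLocalAtTarget.iff_of_iSup_eq_top (P := .isomorphisms _) _
    (iSup_affineOpens_eq_top Y)).mpr fun U ↦ ?_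
  refine (isIso_morphismRestrict_iff_isIso_app _ U.2).mpr ?_
  let := (f.app U.1).hom.toAlgebra
  suffices Function.Bijective
      (algebraMap Γ(Y, U.1) (integralClosure Γ(Y, U.1) Γ(X, f ⁻¹ᵁ U.1))) by
    rw [f.fromNormalization_app U.2]
    have : IsIso (CommRingCat.ofHom
        (algebraMap Γ(Y, U.1) (integralClosure Γ(Y, U.1) Γ(X, f ⁻¹ᵁ U.1)))) :=
      (ConcreteCategory.isIso_iff_bijective _).mpr this
    infer_instance
  by_cases hξ : f (genericPoint X) ∈ U.1
  · refine ⟨fun a b hab ↦ f.app_injective_of_isOpenImmersion_ι_comp V hξ congr(($hab).1), ?_⟩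
    rintro ⟨s, hs⟩
    obtain ⟨r, hr⟩ := f.exists_app_eq_of_isIntegralElem V hY U.2 hξ hs
    exact ⟨r, Subtype.ext hr⟩
  · -- An open set that misses the generic point of `Y` is empty, and then both rings are zero.
    have hU : U.1 = ⊥ := by
      rw [f.apply_genericPoint_of_isOpenImmersion_ι_comp V] at hξ
      rw [← SetLike.coe_set_eq, TopologicalSpace.Opens.coe_bot, ← Set.not_nonempty_iff_eq_empty]
      exact fun h ↦ hξ (((genericPoint_spec Y).mem_open_set_iff U.1.isOpen).mpr (by simpa using h))
    have hX : Subsingleton Γ(X, f ⁻¹ᵁ U.1) := by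
      rw [hU]
      exact inferInstanceAs (Subsingleton Γ(X, ⊥))
    have hY : Subsingleton Γ(Y, U.1) := by
      rw [hU]
      infer_instance
    exact ⟨Function.injective_of_subsingleton _, fun s ↦ ⟨0, Subsingleton.elim _ _⟩⟩

/-- A separated quasi-finite morphism of finite type to a normal scheme which is generically an open
immersion is an open immersion. -/
lemma isOpenImmersion_of_locallyQuasiFinite [LocallyQuasiFinite f] [LocallyOfFiniteType f]
    [IsSeparated f] [QuasiCompact f] (hY : ∀ y : Y, IsIntegrallyClosed (Y.presheaf.stalk y)) :
    IsOpenImmersion f := by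
  have := f.isIso_fromNormalization V hY
  rw [← f.toNormalization_fromNormalization]
  infer_instance

end Scheme.Hom

end AlgebraicGeometry

/-! ### Varieties -/

lemma isBirationalMorphism_of_isOpenImmersion {X Y : Scheme.{0}} (f : X ⟶ Y) [IsOpenImmersion f]
    [Nonempty X] [IrreducibleSpace Y] : IsBirationalMorphism f :=
  ⟨{ source := ⊤
     dense_source := dense_univ
     target := f.opensRange
     dense_target := f.opensRange.isOpen.dense (Set.range_nonempty f)
     iso := X.topIso ≪≫ f.isoOpensRange }, by simp⟩

lemma hasFiniteFibres_of_injective {X Y : Scheme.{0}} {f : X ⟶ Y} (hf : Function.Injective f) :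
    HasFiniteFibres f := fun _ _ ↦
  Set.Subsingleton.finite fun _ ha _ hb ↦ hf (ha.2.trans hb.2.symm)

theorem mainTheorem6 {X Y : Scheme.{0}}
    (pX : X ⟶ Spec (CommRingCat.of ℂ)) (pY : Y ⟶ Spec (CommRingCat.of ℂ))
    (hX : IsIrreducibleComplexVariety pX) (hY : IsIrreducibleComplexVariety pY)
    (hYn : IsNormalScheme Y) (f : X ⟶ Y) (hf : f ≫ pY = pX) :
    IsOpenImmersion f ↔ IsBirationalMorphism f ∧ HasFiniteFibres f := by
  obtain ⟨_, _, _, _, _⟩ := hX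
  obtain ⟨_, _, _, _, _⟩ := hY
  refine ⟨fun _ ↦ ⟨isBirationalMorphism_of_isOpenImmersion f,
    hasFiniteFibres_of_injective f.injective⟩, fun ⟨⟨e, he⟩, hfin⟩ ↦ ?_⟩
  subst hf
  have : IsIntegral X := isIntegral_of_irreducibleSpace_of_isReduced X
  have : IsIntegral Y := isIntegral_of_irreducibleSpace_of_isReduced Y
  have : IsSeparated f := .of_comp f pY
  have : LocallyOfFiniteType f := locallyOfFiniteType_of_comp f pY
  have : QuasiCompact f := .of_comp f pY
  have : JacobsonSpace Y := LocallyOfFiniteType.jacobsonSpace pY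
  have : LocallyQuasiFinite f := .of_finite_inter_closedPoints f hfin
  have : Nonempty e.source := e.dense_source.nonempty.to_subtype
  have : IsOpenImmersion (e.source.ι ≫ f) := he ▸ inferInstance
  exact f.isOpenImmersion_of_locallyQuasiFinite e.source fun y ↦ (hYn y).2
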